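/- Let $G=(V,E)$ be a finite, undirected, unweighted, connected simple graph with at least two nodes, let $s\in V$ be a source node, $\ell\ge 0$ a walk length, and let $\lambda\ge 1$ and $\eta\ge 1$ be integer parameters. A step of the random walk goes from a node to a uniformly random neighbor. All random choices below are made with independent fresh randomness. Consider the following distributed algorithm Single-Random-Walk$(s,\ell)$. *Phase 1.* Every node $v$ creates $\eta\deg(v)$ coupons carrying its ID, and each of them is forwarded along a random walk of length $\lambda+r$, where the numbers $r$ are independent and uniform in $\{0,\dots,\lambda-1\}$: each coupon carries its desired length, and in the iterations $i=1,\dots,2\lambda$ it is kept where it is if its desired length is at most $i-1$, and otherwise it is forwarded to a random neighbor of the node holding it. *Phase 2.* A token carrying the ID of $s$ starts at $s$, with completed length $0$. While the completed length is at most $\ell-2\lambda$, the node $v$ that holds the token calls Sample-Coupon$(v)$; if no coupon created by $v$ is left in the network, it calls Send-More-Coupons$(v,\eta,\lambda)$ and then Sample-Coupon$(v)$ again. The token is sent to the node $v'$ that holds the sampled coupon $C$, the node $v'$ deletes $C$, and the completed length grows by the number of times $C$ was forwarded. When the loop ends, the token is forwarded to random neighbors until $\ell$ steps are completed, and the node holding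 the token outputs the ID on it; the other nodes output nothing. *Sample-Coupon$(v)$.* A breadth-first-search tree rooted at $v$ is constructed (ties may be broken in any way, possibly at random and depending on the coupons currently in the network). Every node holding coupons created by $v$ picks one of them uniformly at random, with count the number of such coupons it holds. From the last level of the tree up to the root, every node that has its own pick or receives coupons from its children samples one of these coupons with probability proportional to their counts, and sends it to its parent together with the sum of the counts. The coupon sampled at the root is returned. *Send-More-Coupons$(v,\eta,\lambda)$.* The node $v$ creates $\eta$ new coupons, each of which is forwarded to a random neighbor in each of $\lambda$ rounds. Then, for $i=0,\dots,\lambda-1$, each coupon that is still moving is, independently, stopped for good with probability $\frac1{\lambda-i}$ and otherwise forwarded to a random neighbor. Then Single-Random-Walk solves the problem 1-RW-DoS: for every node $v$, the probability that $v$ outputs the ID of $s$ when the algorithm finishes is equal to the probability that $v$ is the destination of a random walk of length $\ell$ started at $s$. -/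

import Mathlib

open scoped ENNReal

/-!
# A distributed algorithm sampling the endpoint of a random walk by stitching short walks

All randomized procedures are programs in the probability monad `PMF`: `PMF.bind` runs one
procedure after the other, with fresh independent randomness in every random choice.
-/

set_option linter.unusedSectionVars false

noncomputable section

namespace StitchedWalk

universe u v

/-! ### Elementary random choices -/

/-- Run the random procedure `f a` independently for every entry `a` of a list and collect the
results in order. -/
def drawEach {α : Type u} {β : Type v} (f : α → PMF β) : List α → PMF (List β)
  | [] => PMF.pure []
  | a :: l => (f a).bind fun b => (drawEach f l).map fun bs => b :: bs

/-- A coin that shows `true` with probability `p`. -/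
def coin (p : ℝ≥0∞) (hp : p ≤ 1) : PMF Bool :=
  PMF.ofFintype (fun b => if b then p else 1 - p) (by simp [add_tsub_cancel_of_le hp])

variable {V : Type u} [Fintype V] [DecidableEq V]

/-- One step of the simple random walk: a uniformly random neighbor. (A node without neighbors,
which does not occur in a connected graph with at least two nodes, keeps the walk.) -/
def step (G : SimpleGraph V) [DecidableRel G.Adj] (x : V) : PMF V :=
  if h : (G.neighborFinset x).Nonempty then PMF.uniformOfFinset (G.neighborFinset x) h
  else PMF.pure x

/-- The distribution of the destination of a simple random walk of the given length started at a
given node. -/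
def walk (G : SimpleGraph V) [DecidableRel G.Adj] : ℕ → V → PMF V
  | 0, x => PMF.pure x
  | n + 1, x => (step G x).bind (walk G n)

/-! ### Coupons -/

/-- A coupon: the ID of the node that created it, the node at which it currently is, and the
number of times it has been forwarded. -/
structure Coupon (V : Type u) where
  src : V
  holder : V
  hops : ℕ
deriving DecidableEq

/-- The coupons stored in the network. The coupons stored at the node `x` are those with
`holder = x`; coupons that agree in all their data are indistinguishable. -/
abbrev Network (V : Type u) := Multiset (Coupon V)

/-- The node holding the coupon forwards it to a uniformly random neighbor. -/
def forward (G : SimpleGraph V) [DecidableRel G.Adj] (c : Coupon V) : PMF (Coupon V) :=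
  (step G c.holder).map fun x => ⟨c.src, x, c.hops + 1⟩

/-! ### Phase 1 -/

/-- Every node `x` creates `eta * deg x` coupons; each comes with its desired walk length
`lam + r`, where `r` is uniform in `[0, lam - 1]`. -/
def createCoupons (G : SimpleGraph V) [DecidableRel G.Adj] (lam eta : ℕ) (hlam : 0 < lam) :
    PMF (List (Coupon V × ℕ)) :=
  drawEach
    (fun x => (PMF.uniformOfFinset (Finset.range lam) (Finset.nonempty_range_iff.2 hlam.ne')).map
      fun r => ((⟨x, x, 0⟩ : Coupon V), lam + r))
    ((Finset.univ : Finset V).toList.flatMap fun x => List.replicate (eta * G.degree x) x)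

/-- The `i`-th iteration of the forwarding loop: a coupon whose desired walk length is at most
`i - 1`, the number of steps it can have made before this iteration, is kept where it is; every
other coupon is forwarded to a random neighbor. -/
def phaseOneRound (G : SimpleGraph V) [DecidableRel G.Adj] (i : ℕ) :
    List (Coupon V × ℕ) → PMF (List (Coupon V × ℕ)) :=
  drawEach fun c => if c.2 ≤ i - 1 then PMF.pure c else (forward G c.1).map fun c' => (c', c.2)

/-- The iterations `1, …, n` of the forwarding loop. -/
def phaseOneRounds (G : SimpleGraph V) [DecidableRel G.Adj] :
    ℕ → List (Coupon V × ℕ) → PMF (List (Coupon V × ℕ))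
  | 0, l => PMF.pure l
  | n + 1, l => (phaseOneRounds G n l).bind (phaseOneRound G (n + 1))

/-- Phase 1: create the coupons and run `2 * lam` iterations of the forwarding loop. -/
def phaseOne (G : SimpleGraph V) [DecidableRel G.Adj] (lam eta : ℕ) (hlam : 0 < lam) :
    PMF (Network V) :=
  ((createCoupons G lam eta hlam).bind (phaseOneRounds G (2 * lam))).map
    fun l => (l.map Prod.fst : List (Coupon V))

/-! ### Send-More-Coupons -/

/-- Part 1: forward all the new coupons for `n` rounds. -/
def sendRounds (G : SimpleGraph V) [DecidableRel G.Adj] :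
    ℕ → List (Coupon V) → PMF (List (Coupon V))
  | 0, l => PMF.pure l
  | n + 1, l => (sendRounds G n l).bind (drawEach (forward G))

/-- One iteration of Part 2; the flag of a coupon says whether it has been stopped. Each coupon
that is still moving is stopped with probability `p` and otherwise forwarded once more. -/
def extendRound (G : SimpleGraph V) [DecidableRel G.Adj] (p : ℝ≥0∞) (hp : p ≤ 1) :
    List (Coupon V × Bool) → PMF (List (Coupon V × Bool)) :=
  drawEach fun c =>
    if c.2 then PMF.pure c
    else (coin p hp).bind fun halt =>
      if halt then PMF.pure (c.1, true) else (forward G c.1).map fun c' => (c', false)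

/-- The last `m` iterations of Part 2. Of the iterations `i = 0, …, lam - 1`, the iteration with
`lam - i = m` stops each moving coupon with probability `1 / (lam - i) = 1 / m`. -/
def extendRounds (G : SimpleGraph V) [DecidableRel G.Adj] :
    ℕ → List (Coupon V × Bool) → PMF (List (Coupon V × Bool))
  | 0, l => PMF.pure l
  | m + 1, l =>
      (extendRound G (((m + 1 : ℕ) : ℝ≥0∞)⁻¹)
        (ENNReal.inv_le_one.2 (by exact_mod_cast Nat.succ_le_succ (Nat.zero_le m))) l).bind
        (extendRounds G m)

/-- Send-More-Coupons: the node `x` creates `eta` new coupons, which are forwarded for `lam`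
rounds (Part 1) and then extended probabilistically in `lam` further iterations (Part 2). -/
def sendMoreCoupons (G : SimpleGraph V) [DecidableRel G.Adj] (lam eta : ℕ) (x : V) :
    PMF (Network V) :=
  ((sendRounds G lam (List.replicate eta ⟨x, x, 0⟩)).bind fun l =>
    extendRounds G lam (l.map fun c => (c, false))).map
      fun l => (l.map Prod.fst : List (Coupon V))

/-! ### Sample-Coupon -/

/-- A breadth-first-search tree of `G` rooted at `root`: every other node has a parent, a neighbor
whose distance to the root is smaller by one. -/
structure BFSTree (G : SimpleGraph V) (root : V) where
  parent : V → V
  adj_parent : ∀ x, x ≠ root → G.Adj x (parent x)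
  dist_parent : ∀ x, x ≠ root → G.dist root x = G.dist root (parent x) + 1

/-- Every connected graph has a breadth-first-search tree with any prescribed root. -/
theorem BFSTree.nonempty (G : SimpleGraph V) (hG : G.Connected) (root : V) :
    Nonempty (BFSTree G root) := by
  have key : ∀ x, ∃ y, x ≠ root → G.Adj x y ∧ G.dist root x = G.dist root y + 1 := by
    intro x
    by_cases hx : x = root
    · exact ⟨x, fun h => absurd hx h⟩
    obtain ⟨w, hw⟩ := hG.exists_walk_length_eq_dist x root
    cases w with
    | nil => exact absurd rfl hx
    | @cons _ y _ h p =>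
      refine ⟨y, fun _ => ⟨h, ?_⟩⟩
      have h1 : G.dist y root ≤ p.length := SimpleGraph.dist_le p
      have h2 : G.dist x root ≤ G.dist x y + G.dist y root := hG.dist_triangle
      have h3 : G.dist x y = 1 := SimpleGraph.dist_eq_one_iff_adj.2 h
      rw [SimpleGraph.Walk.length_cons] at hw
      rw [SimpleGraph.dist_comm (u := root) (v := x), SimpleGraph.dist_comm (u := root) (v := y)]
      omega
  choose f hf using key
  exact ⟨⟨f, fun x hx => (hf x hx).1, fun x hx => (hf x hx).2⟩⟩

/-- The children of a node in the tree. -/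
def BFSTree.children {G : SimpleGraph V} {root : V} (T : BFSTree G root) (x : V) : Finset V :=
  Finset.univ.filter fun y => y ≠ root ∧ T.parent y = x

/-- The number of the last level of a breadth-first-search tree rooted at `root`. -/
def depth (G : SimpleGraph V) (root : V) : ℕ := Finset.univ.sup fun x => G.dist root x

/-- The coupons created by `root` that the node `x` holds. -/
def couponsAt (net : Network V) (root x : V) : Network V :=
  net.filter fun c => c.src = root ∧ c.holder = x

/-- A node holding coupons of `root` picks one of them uniformly at random, and the count is the
number of these coupons; a node holding none has nothing to offer. -/
def pickOwn (net : Network V) (root x : V) : PMF (Option (Coupon V × ℕ)) :=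
  if h : couponsAt net root x = 0 then PMF.pure none
  else (PMF.ofMultiset (couponsAt net root x) h).map
    fun c => some (c, Multiset.card (couponsAt net root x))

/-- Sample one of the coupons in a list of coupons with counts, with probabilities proportional
to the counts; the new count is the sum of the counts. There is no result when that sum is `0`. -/
def combine (l : List (Coupon V × ℕ)) : PMF (Option (Coupon V × ℕ)) :=
  if h : ∑' j : Fin l.length, ((l.get j).2 : ℝ≥0∞) = 0 then PMF.pure none
  else (PMF.normalize (fun j : Fin l.length => ((l.get j).2 : ℝ≥0∞)) h
      (by rw [tsum_fintype]; exact ENNReal.sum_ne_top.2 fun j _ => ENNReal.natCast_ne_top _)).map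
    fun j => some ((l.get j).1, (l.map Prod.snd).sum)

/-- The message (a sampled coupon and its count, or nothing) that a node sends to its parent in
the tree, computed from the last level upward. The number `k` is the number of levels below the
level of the node; the nodes of the last level are leaves. -/
def report {G : SimpleGraph V} {root : V} (T : BFSTree G root) (net : Network V) :
    ℕ → V → PMF (Option (Coupon V × ℕ))
  | 0, x => (pickOwn net root x).bind fun own => combine own.toList
  | k + 1, x =>
      (pickOwn net root x).bind fun own =>
        (drawEach (report T net k) (T.children x).toList).bind fun received =>
          combine (own.toList ++ received.reduceOption)

/-- Sample-Coupon: the coupon that is finally sampled at the root of the tree, or `none` when no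
coupon of the root is left in the network. -/
def sampleCoupon {G : SimpleGraph V} {root : V} (T : BFSTree G root) (net : Network V) :
    PMF (Option (Coupon V)) :=
  (report T net (depth G root) root).map fun m => m.map Prod.fst

/-! ### Phase 2 -/

/-- The token: the ID written on it, the node holding it, and the length of the walk completed. -/
structure Token (V : Type u) where
  src : V
  holder : V
  done : ℕ

/-- The token is sent to the node holding the coupon `c`, and this node deletes `c`. -/
def takeCoupon (net : Network V) (t : Token V) (c : Coupon V) : Network V × Token V :=
  (net.erase c, ⟨t.src, c.holder, t.done + c.hops⟩)

/-- One iteration of the stitching loop. The way in which breadth-first-search trees are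
constructed (how ties are broken) is given by `bfs`. The value `none` would mean that no coupon is
found even after Send-More-Coupons. -/
def stitch {G : SimpleGraph V} [DecidableRel G.Adj] (lam eta : ℕ)
    (bfs : Network V → (x : V) → PMF (BFSTree G x)) (net : Network V) (t : Token V) :
    PMF (Option (Network V × Token V)) :=
  ((bfs net t.holder).bind fun T => sampleCoupon T net).bind fun
    | some c => PMF.pure (some (takeCoupon net t c))
    | none =>
        (sendMoreCoupons G lam eta t.holder).bind fun new =>
          ((bfs (net + new) t.holder).bind fun T => sampleCoupon T (net + new)).map
            fun r => r.map (takeCoupon (net + new) t)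

/-- The outputs of all the nodes when the node `x` holds the token at the end: it outputs the ID
`src` written on the token, and the other nodes output nothing. -/
def outputs (src x : V) : V → Option V := fun y => if y = x then some src else none

/-- Phase 2: while the length completed is at most `ell - 2 * lam`, stitch; then walk naively
until `ell` steps are completed, and output. The first argument bounds the number of iterations of
the loop; an execution that fails, or that would need more iterations, ends without any output. -/
def phaseTwo {G : SimpleGraph V} [DecidableRel G.Adj] (ell lam eta : ℕ)
    (bfs : Network V → (x : V) → PMF (BFSTree G x)) :
    ℕ → Network V → Token V → PMF (V → Option V)
  | fuel, net, t =>
    if t.done + 2 * lam ≤ ell then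
      match fuel with
      | 0 => PMF.pure fun _ => none
      | fuel + 1 =>
          (stitch lam eta bfs net t).bind fun
            | some (net', t') => phaseTwo ell lam eta bfs fuel net' t'
            | none => PMF.pure fun _ => none
    else (walk G (ell - t.done) t.holder).map (outputs t.src)

/-- Single-Random-Walk: the joint distribution of the outputs of all the nodes. The loop of
Phase 2 is allowed `ell` iterations (each of them is meant to add at least one step to the walk). -/
def singleRandomWalk {G : SimpleGraph V} [DecidableRel G.Adj] (ell lam eta : ℕ) (hlam : 0 < lam)
    (bfs : Network V → (x : V) → PMF (BFSTree G x)) (s : V) : PMF (V → Option V) :=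
  (phaseOne G lam eta hlam).bind fun net => phaseTwo ell lam eta bfs ell net ⟨s, s, 0⟩

end StitchedWalk

end

/-! The invariant: given the token, the network consists of independent coupons, one for each entry
of a fixed list of sources, each with the law `couponLaw` of a fresh coupon (`netLaw`). Phase 1
creates such a network (`phaseOne_eq`), and Send-More-Coupons adds coupons of the same law
(`sendMoreCoupons_eq`), because the stopping probabilities make the extra length uniform.

Sample-Coupon returns a uniform coupon of the root whatever the tree is (`sampleCoupon_eq`), so a
tree chosen by looking at the network introduces no bias. Coupons with the same source are
exchangeable; hence a uniformly chosen one is a fresh coupon, independent of the others, and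
deleting it preserves the invariant (`mean_netLaw_sum_erase`, `mean_netLaw_sample`). The number of
coupons of each source is determined by the list, so the decision to create more carries no
information about the walks (`mean_stitch`).

A stitch therefore prolongs the walk by `lam + r` fresh steps. For each value of `r`, the rest of
the walk completes it to the required length by `walk_add`, so averaging over `r` changes nothing
(`mean_phaseTwo`). -/

noncomputable section

namespace StitchedWalk

universe u v w

/-! ### Expectations of nonnegative functions -/

/-- The expectation of a nonnegative function. -/
def mean {α : Type u} (p : PMF α) (g : α → ℝ≥0∞) : ℝ≥0∞ := ∑' a, p a * g a

section Mean

variable {α : Type u} {β : Type v} {γ : Type w}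

theorem mean_pure (a : α) (g : α → ℝ≥0∞) : mean (PMF.pure a) g = g a := by
  classical
  unfold mean
  rw [tsum_eq_single a]
  · simp
  · intro b hb
    simp [PMF.pure_apply, hb]

theorem mean_bind (p : PMF α) (f : α → PMF β) (g : β → ℝ≥0∞) :
    mean (p.bind f) g = mean p fun a => mean (f a) g := by
  simp only [mean, PMF.bind_apply, ← ENNReal.tsum_mul_right, ← ENNReal.tsum_mul_left]
  rw [ENNReal.tsum_comm]
  simp only [mul_assoc]

theorem mean_map (p : PMF α) (f : α → β) (g : β → ℝ≥0∞) :
    mean (p.map f) g = mean p fun a => g (f a) := by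
  rw [← PMF.bind_pure_comp, mean_bind]
  simp [mean_pure]

theorem mean_const (p : PMF α) (r : ℝ≥0∞) : mean p (fun _ => r) = r := by
  simp [mean, ENNReal.tsum_mul_right, p.tsum_coe]

theorem mean_add (p : PMF α) (g h : α → ℝ≥0∞) :
    mean p (fun a => g a + h a) = mean p g + mean p h := by
  simp [mean, mul_add, ENNReal.tsum_add]

theorem mean_const_mul (p : PMF α) (r : ℝ≥0∞) (g : α → ℝ≥0∞) :
    mean p (fun a => r * g a) = r * mean p g := by
  simp only [mean, ← ENNReal.tsum_mul_left]
  exact tsum_congr fun a => by ring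

theorem mean_sum {ι : Type w} (p : PMF α) (s : Finset ι) (g : ι → α → ℝ≥0∞) :
    mean p (fun a => ∑ i ∈ s, g i a) = ∑ i ∈ s, mean p (g i) := by
  classical
  induction s using Finset.induction_on with
  | empty => simp [mean]
  | insert i s hi ih => simp only [Finset.sum_insert hi, mean_add, ih]

theorem mean_comm (p : PMF α) (q : PMF β) (g : α → β → ℝ≥0∞) :
    (mean p fun a => mean q fun b => g a b) = mean q fun b => mean p fun a => g a b := by
  simp only [mean, ← ENNReal.tsum_mul_left]
  rw [ENNReal.tsum_comm]
  exact tsum_congr fun b => tsum_congr fun a => by ring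

theorem mean_congr (p : PMF α) {g h : α → ℝ≥0∞} (H : ∀ a ∈ p.support, g a = h a) :
    mean p g = mean p h := by
  refine tsum_congr fun a => ?_
  by_cases ha : p a = 0
  · simp [ha]
  · rw [H a ((p.mem_support_iff a).2 ha)]

theorem mean_indicator (p : PMF α) [DecidableEq α] (a : α) :
    mean p (fun b => if b = a then 1 else 0) = p a := by
  unfold mean
  rw [tsum_eq_single a]
  · simp
  · intro b hb
    simp [hb]

theorem pmf_ext_mean {p q : PMF α} (h : ∀ g, mean p g = mean q g) : p = q := by
  classical
  ext a
  rw [← mean_indicator p a, h, mean_indicator]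

theorem toOuterMeasure_eq_mean (p : PMF α) (s : Set α) [DecidablePred (· ∈ s)] :
    p.toOuterMeasure s = mean p fun a => if a ∈ s then 1 else 0 := by
  rw [PMF.toOuterMeasure_apply]
  refine tsum_congr fun a => ?_
  by_cases ha : a ∈ s <;> simp [ha]

theorem mean_uniformOfFinset (s : Finset α) (hs : s.Nonempty) (g : α → ℝ≥0∞) :
    mean (PMF.uniformOfFinset s hs) g = (s.card : ℝ≥0∞)⁻¹ * ∑ a ∈ s, g a := by
  classical
  unfold mean
  rw [tsum_eq_sum (s := s), Finset.mul_sum]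
  · exact Finset.sum_congr rfl fun a ha => by rw [PMF.uniformOfFinset_apply_of_mem hs ha]
  · intro a ha
    rw [PMF.uniformOfFinset_apply_of_notMem hs ha, zero_mul]

theorem mean_ofMultiset (s : Multiset α) (hs : s ≠ 0) (g : α → ℝ≥0∞) :
    mean (PMF.ofMultiset s hs) g = (Multiset.card s : ℝ≥0∞)⁻¹ * (s.map g).sum := by
  classical
  unfold mean
  rw [tsum_eq_sum (s := s.toFinset), Finset.sum_multiset_map_count, Finset.mul_sum]
  · refine Finset.sum_congr rfl fun a _ => ?_
    rw [PMF.ofMultiset_apply, nsmul_eq_mul, div_eq_mul_inv]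
    ring
  · intro a ha
    rw [PMF.ofMultiset_apply_of_notMem hs (by simpa using ha), zero_mul]

theorem mean_coin (p : ℝ≥0∞) (hp : p ≤ 1) (g : Bool → ℝ≥0∞) :
    mean (coin p hp) g = p * g true + (1 - p) * g false := by
  simp [mean, tsum_fintype, coin, PMF.ofFintype_apply]

theorem mean_pos_mul_inv {n : ℕ} (hn : 0 < n) (r : ℝ≥0∞) :
    (n : ℝ≥0∞)⁻¹ * (n * r) = r := by
  rw [← mul_assoc, ENNReal.inv_mul_cancel (by exact_mod_cast hn.ne') (ENNReal.natCast_ne_top n),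
    one_mul]

end Mean

/-! ### Independent repetitions -/

section DrawEach

variable {α : Type u} {β : Type v} {γ : Type w}

/-- Independent choices for different entries commute. This turns synchronous rounds over all
coupons into a separate process for each coupon. -/
theorem drawEach_bind (f : α → PMF β) (g : β → PMF γ) (l : List α) :
    (drawEach f l).bind (drawEach g) = drawEach (fun a => (f a).bind g) l := by
  induction l with
  | nil => simp [drawEach, PMF.pure_bind]
  | cons a l ih =>
    simp only [drawEach, PMF.bind_bind, PMF.bind_map, Function.comp_def, ← ih]
    refine congrArg _ (funext fun b => ?_)
    rw [PMF.bind_comm]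
    simp only [PMF.map_bind]

theorem drawEach_pure (l : List α) : drawEach PMF.pure l = PMF.pure l := by
  induction l with
  | nil => rfl
  | cons a l ih => simp [drawEach, ih, PMF.pure_bind, PMF.pure_map]

theorem drawEach_map_list (f : α → β) (g : β → PMF γ) (l : List α) :
    drawEach g (l.map f) = drawEach (fun a => g (f a)) l := by
  induction l with
  | nil => rfl
  | cons a l ih => simp [drawEach, ih]

theorem map_drawEach (f : α → PMF β) (g : β → γ) (l : List α) :
    (drawEach f l).map (List.map g) = drawEach (fun a => (f a).map g) l := by
  have h : drawEach (fun b => PMF.pure (g b)) = fun l : List β => PMF.pure (l.map g) := by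
    funext l
    rw [← drawEach_pure, drawEach_map_list]
  have := drawEach_bind f (fun b => PMF.pure (g b)) l
  rw [h] at this
  simpa only [← PMF.bind_pure_comp, Function.comp_def] using this

theorem drawEach_congr {f g : α → PMF β} {l : List α} (h : ∀ a ∈ l, f a = g a) :
    drawEach f l = drawEach g l := by
  induction l with
  | nil => rfl
  | cons a l ih =>
    simp only [List.mem_cons, forall_eq_or_imp] at h
    simp only [drawEach, h.1, ih h.2]

end DrawEach

/-! ### Sampling with probabilities proportional to counts -/

section Sampling

variable {α : Type u} [DecidableEq α]

/-- A uniformly random element of a multiset together with the size of the multiset. -/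
def uniformCounted (s : Multiset α) : PMF (Option (α × ℕ)) :=
  if h : s = 0 then PMF.pure none
  else (PMF.ofMultiset s h).map fun c => some (c, Multiset.card s)

theorem mean_uniformCounted (s : Multiset α) (g : Option (α × ℕ) → ℝ≥0∞) :
    mean (uniformCounted s) g = if s = 0 then g none else
      (Multiset.card s : ℝ≥0∞)⁻¹ * (s.map fun c => g (some (c, Multiset.card s))).sum := by
  unfold uniformCounted
  split_ifs with h
  · rw [mean_pure]
  · rw [mean_map, mean_ofMultiset]

/-- The weighted sum of the values of a function on the entries of a list of counted elements. -/
def countedSum (h : α → ℝ≥0∞) (l : List (α × ℕ)) : ℝ≥0∞ :=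
  (l.map fun c => (c.2 : ℝ≥0∞) * h c.1).sum

/-- The count attached to a pick cancels the factor `1 / card` of the uniform choice, so each
multiset contributes its full sum; an empty one contributes nothing. -/
theorem mean_drawEach_countedSum (h : α → ℝ≥0∞) (l : List (Multiset α)) :
    mean (drawEach uniformCounted l) (fun r => countedSum h r.reduceOption) =
      (l.sum.map h).sum := by
  induction l with
  | nil => simp [drawEach, mean_pure, countedSum]
  | cons s l ih =>
    have key : mean (uniformCounted s) (fun o => countedSum h o.toList) = (s.map h).sum := by
      rw [mean_uniformCounted]
      split_ifs with hs
      · simp [countedSum, hs]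
      · simp only [countedSum, Option.toList_some, List.map_cons, List.map_nil, List.sum_cons,
          List.sum_nil, add_zero]
        rw [Multiset.sum_map_mul_left, mean_pos_mul_inv (Multiset.card_pos.2 hs)]
    have split : ∀ (o : Option (α × ℕ)) r, countedSum h (o :: r).reduceOption =
        countedSum h o.toList + countedSum h r.reduceOption := by
      intro o r
      cases o <;> simp [countedSum, List.reduceOption_cons_of_some, List.reduceOption_cons_of_none]
    simp only [drawEach, mean_bind, mean_map, split, mean_add, mean_const, ih, key,
      List.sum_cons, Multiset.map_add, Multiset.sum_add]

/-- The picks are random but their total count is not, so the normalizing factor in `combine` can be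
taken out of the expectation. -/
theorem sum_counts_of_mem_support (l : List (Multiset α)) (r : List (Option (α × ℕ)))
    (hr : r ∈ (drawEach uniformCounted l).support) :
    (r.reduceOption.map Prod.snd).sum = Multiset.card l.sum := by
  induction l generalizing r with
  | nil =>
    simp only [drawEach, PMF.support_pure, Set.mem_singleton_iff] at hr
    simp [hr]
  | cons s l ih =>
    simp only [drawEach, PMF.mem_support_bind_iff, PMF.mem_support_map_iff] at hr
    obtain ⟨o, ho, r', hr', rfl⟩ := hr
    unfold uniformCounted at ho
    split_ifs at ho with hs
    · simp only [PMF.support_pure, Set.mem_singleton_iff] at ho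
      simp [ho, hs, List.reduceOption_cons_of_none, ih r' hr']
    · obtain ⟨c, -, rfl⟩ := (PMF.mem_support_map_iff _ _ _).1 ho
      simp [List.reduceOption_cons_of_some, ih r' hr']

end Sampling

/-! ### Uniformity of Sample-Coupon -/

section SampleCoupon

variable {V : Type u} [Fintype V] [DecidableEq V]

theorem mean_combine (l : List (Coupon V × ℕ)) (g : Option (Coupon V × ℕ) → ℝ≥0∞) :
    mean (combine l) g = if (l.map Prod.snd).sum = 0 then g none else
      ((l.map Prod.snd).sum : ℝ≥0∞)⁻¹ *
        countedSum (fun c => g (some (c, (l.map Prod.snd).sum))) l := by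
  have total : ∑' j : Fin l.length, ((l.get j).2 : ℝ≥0∞) = ((l.map Prod.snd).sum : ℕ) := by
    rw [tsum_fintype, ← Nat.cast_sum, ← List.sum_ofFn]
    congr 2
    exact List.ext_getElem (by simp) (by simp)
  unfold combine
  by_cases h : (l.map Prod.snd).sum = 0
  · rw [dif_pos (by rw [total, h, Nat.cast_zero]), if_pos h, mean_pure]
  · rw [dif_neg (by rw [total]; exact_mod_cast h), if_neg h, mean_map]
    unfold mean
    simp only [PMF.normalize_apply, total]
    rw [tsum_fintype, countedSum, Finset.sum_congr rfl fun j _ => mul_right_comm _ _ _,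
      ← Finset.sum_mul, mul_comm, ← List.sum_ofFn]
    congr 2
    exact List.ext_getElem (by simp) (by simp)

/-- The inductive step up the tree: choosing a part in proportion to its size and a uniform element
within it is a uniform choice from the union. -/
theorem drawEach_uniformCounted_bind_combine (l : List (Network V)) :
    (drawEach uniformCounted l).bind (fun r => combine r.reduceOption) =
      uniformCounted l.sum := by
  refine pmf_ext_mean fun g => ?_
  rw [mean_bind, mean_uniformCounted]
  have h : ∀ r ∈ (drawEach uniformCounted l).support, mean (combine r.reduceOption) g =
      if l.sum = 0 then g none else (Multiset.card l.sum : ℝ≥0∞)⁻¹ *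
        countedSum (fun c => g (some (c, Multiset.card l.sum))) r.reduceOption := by
    intro r hr
    rw [mean_combine, sum_counts_of_mem_support l r hr]
    simp only [Multiset.card_eq_zero]
  rw [mean_congr _ h]
  split_ifs
  · rw [mean_const]
  · rw [mean_const_mul, mean_drawEach_countedSum]

/-- The coupons of the root held in the subtree of a node, down to `k` levels below the node. -/
def subtreeCoupons {G : SimpleGraph V} {root : V} (T : BFSTree G root) (net : Network V) :
    ℕ → V → Network V
  | 0, x => couponsAt net root x
  | k + 1, x => couponsAt net root x + ∑ y ∈ T.children x, subtreeCoupons T net k y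

theorem report_eq {G : SimpleGraph V} {root : V} (T : BFSTree G root) (net : Network V)
    (k : ℕ) (x : V) : report T net k x = uniformCounted (subtreeCoupons T net k x) := by
  have own : ∀ (o : Option (Coupon V × ℕ)) r,
      o.toList ++ r.reduceOption = (o :: r).reduceOption := by
    intro o r
    cases o <;> simp [List.reduceOption_cons_of_some, List.reduceOption_cons_of_none]
  induction k generalizing x with
  | zero =>
    have := drawEach_uniformCounted_bind_combine [couponsAt net root x]
    simp only [drawEach, PMF.pure_map, PMF.bind_bind, PMF.pure_bind, ← own,
      List.reduceOption_nil, List.append_nil, List.sum_singleton] at this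
    exact this
  | succ k ih =>
    have hk : report T net k = fun y => uniformCounted (subtreeCoupons T net k y) := funext ih
    have := drawEach_uniformCounted_bind_combine
      (couponsAt net root x :: (T.children x).toList.map (subtreeCoupons T net k))
    simp only [drawEach, PMF.bind_bind, PMF.bind_map, Function.comp_def, ← own,
      drawEach_map_list, List.sum_cons, Finset.sum_map_toList] at this
    rw [report, hk]
    exact this

/-- The coupons in the network created by a given node. -/
def couponsOf (net : Network V) (x : V) : Network V := net.filter fun c => c.src = x

theorem sum_couponsAt (net : Network V) (root : V) :
    ∑ x, couponsAt net root x = couponsOf net root := by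
  ext c
  rw [Multiset.count_sum']
  by_cases hc : c.src = root <;> simp [couponsAt, couponsOf, Multiset.count_filter, hc]

theorem dist_le_depth (G : SimpleGraph V) (root x : V) : G.dist root x ≤ depth G root :=
  Finset.le_sup (f := fun x => G.dist root x) (Finset.mem_univ x)

/-- Summing over a whole level avoids proving that subtrees are disjoint: the parent map sends each
level into the one above, and its fibers are the sets of children. -/
theorem sum_subtreeCoupons_level {G : SimpleGraph V} {root : V}
    (T : BFSTree G root) (net : Network V) (k : ℕ) (hk : k ≤ depth G root) :
    ∑ x with G.dist root x + k = depth G root, subtreeCoupons T net k x =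
      ∑ x with depth G root ≤ G.dist root x + k, couponsAt net root x := by
  induction k with
  | zero =>
    refine Finset.sum_congr (Finset.filter_congr fun x _ => ?_) fun x _ => rfl
    have := dist_le_depth G root x
    omega
  | succ k ih =>
    have maps : ∀ y ∈ ({y | G.dist root y + k = depth G root} : Finset V),
        T.parent y ∈ ({x | G.dist root x + (k + 1) = depth G root} : Finset V) := by
      intro y hy
      simp only [Finset.mem_filter, Finset.mem_univ, true_and] at hy ⊢
      have hy' : y ≠ root := by
        rintro rfl
        rw [SimpleGraph.dist_self] at hy
        omega
      have := T.dist_parent y hy'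
      omega
    have children : ∀ x ∈ ({x | G.dist root x + (k + 1) = depth G root} : Finset V),
        T.children x =
          ({y | G.dist root y + k = depth G root} : Finset V).filter fun y => T.parent y = x := by
      intro x hx
      ext y
      simp only [BFSTree.children, Finset.mem_filter, Finset.mem_univ, true_and] at hx ⊢
      refine and_congr_left fun hyx => ⟨fun hy => ?_, fun hy => ?_⟩
      · have := T.dist_parent y hy
        rw [hyx] at this
        omega
      · rintro rfl
        rw [SimpleGraph.dist_self] at hy
        omega
    have below : ∑ x with G.dist root x + (k + 1) = depth G root,
        ∑ y ∈ T.children x, subtreeCoupons T net k y =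
          ∑ y with G.dist root y + k = depth G root, subtreeCoupons T net k y := by
      rw [← Finset.sum_fiberwise_of_maps_to maps]
      exact Finset.sum_congr rfl fun x hx => by rw [children x hx]
    simp only [subtreeCoupons]
    rw [Finset.sum_add_distrib, below, ih (by omega), ← Finset.sum_union]
    · refine Finset.sum_congr ?_ fun x _ => rfl
      ext x
      simp only [Finset.mem_union, Finset.mem_filter, Finset.mem_univ, true_and]
      omega
    · rw [Finset.disjoint_filter]
      intro x _ h
      omega

theorem subtreeCoupons_depth {G : SimpleGraph V} (hG : G.Connected) {root : V}
    (T : BFSTree G root) (net : Network V) :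
    subtreeCoupons T net (depth G root) root = couponsOf net root := by
  have h := sum_subtreeCoupons_level T net (depth G root) le_rfl
  -- Unreachable nodes would also have distance `0` by convention; connectedness leaves only the
  -- root.
  have level : ({x | G.dist root x + depth G root = depth G root} : Finset V) = {root} := by
    ext x
    simp [hG.dist_eq_zero_iff, eq_comm]
  rw [level, Finset.sum_singleton, Finset.filter_true_of_mem fun x _ => Nat.le_add_left _ _,
    sum_couponsAt] at h
  exact h

/-- Whatever the tree is, Sample-Coupon returns a uniformly random coupon of the root. -/
theorem sampleCoupon_eq {G : SimpleGraph V} (hG : G.Connected) {root : V}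
    (T : BFSTree G root) (net : Network V) :
    sampleCoupon T net =
      (uniformCounted (couponsOf net root)).map fun m => m.map Prod.fst := by
  rw [sampleCoupon, report_eq, subtreeCoupons_depth hG]

end SampleCoupon

/-! ### Walks of single coupons -/

section Walks

variable {V : Type u} [Fintype V] [DecidableEq V] (G : SimpleGraph V) [DecidableRel G.Adj]

theorem walk_add (m n : ℕ) (x : V) : walk G (m + n) x = (walk G m x).bind (walk G n) := by
  induction m generalizing x with
  | zero => simp [walk, PMF.pure_bind]
  | succ m ih =>
    rw [Nat.succ_add, walk, walk, PMF.bind_bind]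
    exact congrArg _ (funext ih)

theorem walk_one (x : V) : walk G 1 x = step G x := by
  simp [walk, PMF.bind_pure]

/-- Forward a coupon `n` times. -/
def forwards (n : ℕ) (c : Coupon V) : PMF (Coupon V) :=
  (walk G n c.holder).map fun y => ⟨c.src, y, c.hops + n⟩

theorem forwards_zero (c : Coupon V) : forwards G 0 c = PMF.pure c := by
  simp [forwards, walk, PMF.pure_map]

theorem forwards_one (c : Coupon V) : forwards G 1 c = forward G c := by
  rw [forwards, walk_one]
  rfl

theorem forwards_add (m n : ℕ) (c : Coupon V) :
    forwards G (m + n) c = (forwards G m c).bind (forwards G n) := by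
  simp only [forwards, walk_add, PMF.map_bind, PMF.bind_map, Function.comp_def, Nat.add_assoc]

/-- The distribution of a coupon created by `x` at the end of its walk. -/
def couponLaw (lam : ℕ) (hlam : 0 < lam) (x : V) : PMF (Coupon V) :=
  (PMF.uniformOfFinset (Finset.range lam) (Finset.nonempty_range_iff.2 hlam.ne')).bind
    fun r => forwards G (lam + r) ⟨x, x, 0⟩

theorem mean_couponLaw (lam : ℕ) (hlam : 0 < lam) (x : V) (g : Coupon V → ℝ≥0∞) :
    mean (couponLaw G lam hlam x) g = (lam : ℝ≥0∞)⁻¹ *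
      ∑ r ∈ Finset.range lam, mean (forwards G (lam + r) ⟨x, x, 0⟩) g := by
  rw [couponLaw, mean_bind, mean_uniformOfFinset, Finset.card_range]

/-- The distribution of a network holding one independent coupon for every entry of a list of
sources. -/
def netLaw (lam : ℕ) (hlam : 0 < lam) (l : List V) : PMF (Network V) :=
  (drawEach (couponLaw G lam hlam) l).map Multiset.ofList

theorem map_fst_ofList {β : Type v} (p : PMF (List (Coupon V × β))) :
    p.map (fun l => Multiset.ofList (l.map Prod.fst)) =
      (p.map (List.map Prod.fst)).map Multiset.ofList := by
  rw [PMF.map_comp]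
  rfl

/-! ### Phase 1 -/

theorem phaseOneRounds_eq (n : ℕ) (l : List (Coupon V × ℕ)) :
    phaseOneRounds G n l =
      drawEach (fun c => (forwards G (min n c.2) c.1).map fun c' => (c', c.2)) l := by
  induction n with
  | zero =>
    simp only [phaseOneRounds, Nat.zero_min, forwards_zero, PMF.pure_map]
    exact (drawEach_pure l).symm
  | succ n ih =>
    rw [phaseOneRounds, ih, phaseOneRound, drawEach_bind]
    congr 1
    funext c
    rw [PMF.bind_map]
    simp only [Function.comp_def, Nat.add_sub_cancel]
    by_cases h : c.2 ≤ n
    · simp only [if_pos h, min_eq_right h, min_eq_right (h.trans n.le_succ)]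
      exact PMF.bind_pure_comp _ _
    · rw [min_eq_left (by omega), min_eq_left (by omega), forwards_add, PMF.map_bind]
      simp only [if_neg h, forwards_one]

theorem phaseOne_eq (lam eta : ℕ) (hlam : 0 < lam) :
    phaseOne G lam eta hlam = netLaw G lam hlam
      ((Finset.univ : Finset V).toList.flatMap fun x => List.replicate (eta * G.degree x) x) := by
  rw [phaseOne, createCoupons, netLaw, funext (phaseOneRounds_eq G (2 * lam)), drawEach_bind]
  rw [map_fst_ofList, map_drawEach]
  congr 1
  refine drawEach_congr fun x _ => ?_
  refine pmf_ext_mean fun g => ?_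
  simp only [mean_map, mean_bind, mean_couponLaw, mean_uniformOfFinset, Finset.card_range]
  congr 1
  refine Finset.sum_congr rfl fun r hr => ?_
  -- Since `r < lam`, the `2 * lam` iterations suffice for every desired length `lam + r`.
  rw [min_eq_right]
  have := Finset.mem_range.1 hr
  omega

/-! ### Send-More-Coupons -/

theorem sendRounds_eq (n : ℕ) (l : List (Coupon V)) :
    sendRounds G n l = drawEach (forwards G n) l := by
  induction n with
  | zero => simp only [sendRounds, funext (forwards_zero G), drawEach_pure]
  | succ n ih =>
    rw [sendRounds, ih, drawEach_bind, funext (forwards_add G n 1), funext (forwards_one G)]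

/-- The last `m` iterations of the probabilistic extension for a single coupon. -/
def extendOne : ℕ → Coupon V × Bool → PMF (Coupon V × Bool)
  | 0, c => PMF.pure c
  | m + 1, c =>
      (if c.2 then PMF.pure c
        else (coin (((m + 1 : ℕ) : ℝ≥0∞)⁻¹)
            (ENNReal.inv_le_one.2 (by exact_mod_cast Nat.succ_le_succ (Nat.zero_le m)))).bind
          fun halt => if halt then PMF.pure (c.1, true)
            else (forward G c.1).map fun c' => (c', false)).bind (extendOne m)

theorem extendRounds_eq (m : ℕ) (l : List (Coupon V × Bool)) :
    extendRounds G m l = drawEach (extendOne G m) l := by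
  induction m generalizing l with
  | zero =>
    rw [extendRounds]
    exact (drawEach_pure l).symm
  | succ m ih =>
    rw [extendRounds, extendRound, funext ih, drawEach_bind]
    rfl

theorem extendOne_true (m : ℕ) (c : Coupon V) :
    extendOne G m (c, true) = PMF.pure (c, true) := by
  induction m with
  | zero => rfl
  | succ m ih => simp [extendOne, PMF.pure_bind, ih]

/-- The extra length is uniform on `0, …, m - 1`: stopping at once has probability `1 / m`, and each
later value gets `(m - 1) / m` times `1 / (m - 1)`. Multiplying by `m` avoids division in the
induction. -/
theorem mean_extendOne (m : ℕ) (c : Coupon V) (g : Coupon V → ℝ≥0∞) :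
    (m : ℝ≥0∞) * mean (extendOne G m (c, false)) (fun c' => g c'.1) =
      ∑ r ∈ Finset.range m, mean (forwards G r c) g := by
  induction m generalizing c with
  | zero => simp
  | succ m ih =>
    have cancel : ((m + 1 : ℕ) : ℝ≥0∞) * ((m + 1 : ℕ) : ℝ≥0∞)⁻¹ = 1 :=
      ENNReal.mul_inv_cancel (by exact_mod_cast m.succ_ne_zero) (ENNReal.natCast_ne_top _)
    have rest : ((m + 1 : ℕ) : ℝ≥0∞) * (1 - ((m + 1 : ℕ) : ℝ≥0∞)⁻¹) = m := by
      rw [ENNReal.mul_sub fun _ _ => ENNReal.natCast_ne_top _, cancel, mul_one, Nat.cast_add,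
        Nat.cast_one, ENNReal.add_sub_cancel_right ENNReal.one_ne_top]
    rw [extendOne]
    simp only [Bool.false_eq_true, if_false, if_true, mean_bind, mean_coin, extendOne_true, mean_pure,
      mean_map]
    rw [mul_add, ← mul_assoc, ← mul_assoc, cancel, rest, one_mul]
    rw [← mean_const_mul]
    simp only [ih]
    -- The term `r = 0` is the immediate stop; the others begin with one forwarding.
    rw [mean_sum, Finset.sum_range_succ', forwards_zero, mean_pure, add_comm (g c)]
    refine congrArg (· + g c) (Finset.sum_congr rfl fun r _ => ?_)
    rw [add_comm r 1, forwards_add, mean_bind, forwards_one]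

theorem sendMoreCoupons_eq (lam eta : ℕ) (hlam : 0 < lam) (x : V) :
    sendMoreCoupons G lam eta x = netLaw G lam hlam (List.replicate eta x) := by
  rw [sendMoreCoupons, map_fst_ofList, netLaw]
  congr 1
  simp only [sendRounds_eq, extendRounds_eq, drawEach_map_list, drawEach_bind, map_drawEach]
  rw [← List.map_replicate (f := fun y : V => (⟨y, y, 0⟩ : Coupon V)), drawEach_map_list]
  refine drawEach_congr fun y _ => ?_
  refine pmf_ext_mean fun g => ?_
  rw [mean_couponLaw, mean_map, mean_bind]
  simp only [forwards_add, mean_bind]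
  rw [← mean_sum]
  simp only [← mean_extendOne]
  rw [mean_const_mul, mean_pos_mul_inv hlam]

end Walks

section Stitching

variable {V : Type u} [Fintype V] [DecidableEq V] (G : SimpleGraph V) [DecidableRel G.Adj]
  (lam : ℕ) (hlam : 0 < lam)

/-! ### Networks of independent coupons -/

theorem src_of_mem_support_couponLaw {x : V} {c : Coupon V}
    (hc : c ∈ (couponLaw G lam hlam x).support) : c.src = x := by
  simp only [couponLaw, forwards, PMF.mem_support_bind_iff, PMF.mem_support_map_iff] at hc
  obtain ⟨r, -, y, -, rfl⟩ := hc
  rfl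

theorem netLaw_nil : netLaw G lam hlam [] = PMF.pure 0 := by
  simp [netLaw, drawEach, PMF.pure_map]

theorem netLaw_cons (x : V) (l : List V) :
    netLaw G lam hlam (x :: l) =
      (couponLaw G lam hlam x).bind fun c => (netLaw G lam hlam l).map (c ::ₘ ·) := by
  simp only [netLaw, drawEach, PMF.map_bind, PMF.map_comp, Function.comp_def, Multiset.cons_coe]

theorem netLaw_append (l l' : List V) :
    netLaw G lam hlam (l ++ l') =
      (netLaw G lam hlam l).bind fun net => (netLaw G lam hlam l').map (net + ·) := by
  induction l with
  | nil =>
    rw [netLaw_nil, PMF.pure_bind]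
    simp only [zero_add, List.nil_append]
    exact (PMF.map_id _).symm
  | cons x l ih =>
    simp only [List.cons_append, netLaw_cons, ih, PMF.bind_bind, PMF.map_bind, PMF.bind_map,
      PMF.map_comp, Function.comp_def, Multiset.cons_add]

theorem netLaw_perm {l l' : List V} (h : l.Perm l') :
    netLaw G lam hlam l = netLaw G lam hlam l' := by
  induction h with
  | nil => rfl
  | cons x _ ih => simp only [netLaw_cons, ih]
  | swap x y l =>
    simp only [netLaw_cons, PMF.map_bind, PMF.map_comp, Function.comp_def]
    rw [PMF.bind_comm]
    simp only [Multiset.cons_swap]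
  | trans _ _ ih₁ ih₂ => exact ih₁.trans ih₂

theorem card_couponsOf_of_mem_support (x : V) (l : List V) {net : Network V}
    (h : net ∈ (netLaw G lam hlam l).support) :
    Multiset.card (couponsOf net x) = l.count x := by
  induction l generalizing net with
  | nil =>
    simp only [netLaw_nil, PMF.support_pure, Set.mem_singleton_iff] at h
    simp [h, couponsOf]
  | cons y l ih =>
    simp only [netLaw_cons, PMF.mem_support_bind_iff, PMF.mem_support_map_iff] at h
    obtain ⟨c, hc, net', hnet', rfl⟩ := h
    have := src_of_mem_support_couponLaw G lam hlam hc
    have ih := ih hnet'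
    unfold couponsOf at ih ⊢
    by_cases hy : y = x
    · rw [Multiset.filter_cons_of_pos _ (by rw [this, hy]), Multiset.card_cons, ih, hy,
        List.count_cons_self]
    · rw [Multiset.filter_cons_of_neg _ (by rwa [this]), ih, List.count_cons_of_ne hy]

/-- Summing over the coupons of `x` in a network of independent coupons, each one looks like a
fresh coupon, and independent of the rest of the network. -/
theorem mean_netLaw_sum_erase (x : V) (l : List V) (F : Coupon V → Network V → ℝ≥0∞) :
    mean (netLaw G lam hlam l)
        (fun net => ((couponsOf net x).map fun c => F c (net.erase c)).sum) =
      l.count x * mean (couponLaw G lam hlam x) fun c =>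
        mean (netLaw G lam hlam (l.erase x)) (F c) := by
  induction l generalizing F with
  | nil => simp [netLaw_nil, mean_pure, couponsOf]
  | cons y l ih =>
    -- If `c` has the same data as `a`, erasing either copy leaves the same multiset.
    have tail : ∀ (a : Coupon V) (net : Network V),
        ((couponsOf net x).map fun c => F c ((a ::ₘ net).erase c)) =
          (couponsOf net x).map fun c => F c (a ::ₘ net.erase c) := by
      intro a net
      refine Multiset.map_congr rfl fun c hc => ?_
      have hc' : c ∈ net := Multiset.mem_of_mem_filter hc
      by_cases hca : a = c
      · rw [hca, Multiset.erase_cons_head, Multiset.cons_erase hc']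
      · rw [Multiset.erase_cons_tail _ hca]
    simp only [netLaw_cons, mean_bind, mean_map]
    by_cases hy : y = x
    · subst hy
      have head : ∀ a ∈ (couponLaw G lam hlam y).support,
          mean (netLaw G lam hlam l) (fun net =>
            ((couponsOf (a ::ₘ net) y).map fun c => F c ((a ::ₘ net).erase c)).sum) =
          mean (netLaw G lam hlam l) (F a) + l.count y *
            mean (couponLaw G lam hlam y) fun c =>
              mean (netLaw G lam hlam (l.erase y)) fun net => F c (a ::ₘ net) := by
        intro a ha
        rw [← ih fun c net => F c (a ::ₘ net), ← mean_add]
        refine mean_congr _ fun net _ => ?_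
        have : couponsOf (a ::ₘ net) y = a ::ₘ couponsOf net y :=
          Multiset.filter_cons_of_pos _ (src_of_mem_support_couponLaw G lam hlam ha)
        rw [this, Multiset.map_cons, Multiset.sum_cons, tail, Multiset.erase_cons_head]
      -- Either the head coupon is the chosen one, or it joins the remaining coupons; in the latter
      -- case it takes the place of the chosen coupon's entry in `l`.
      rw [mean_congr _ head, mean_add, mean_const_mul, List.count_cons_self, List.erase_cons_head,
        mean_comm (couponLaw G lam hlam y) (couponLaw G lam hlam y)]
      by_cases hl : y ∈ l
      · have : ∀ c, (mean (couponLaw G lam hlam y) fun a =>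
            mean (netLaw G lam hlam (l.erase y)) fun net => F c (a ::ₘ net)) =
              mean (netLaw G lam hlam l) (F c) := by
          intro c
          rw [netLaw_perm G lam hlam (List.perm_cons_erase hl), netLaw_cons, mean_bind]
          simp only [mean_map]
        simp only [this]
        push_cast
        ring
      · simp [List.count_eq_zero_of_not_mem hl]
    · have head : ∀ a ∈ (couponLaw G lam hlam y).support,
          mean (netLaw G lam hlam l) (fun net =>
            ((couponsOf (a ::ₘ net) x).map fun c => F c ((a ::ₘ net).erase c)).sum) =
          l.count x * mean (couponLaw G lam hlam x) fun c =>
              mean (netLaw G lam hlam (l.erase x)) fun net => F c (a ::ₘ net) := by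
        intro a ha
        rw [← ih fun c net => F c (a ::ₘ net)]
        refine mean_congr _ fun net _ => ?_
        have : couponsOf (a ::ₘ net) x = couponsOf net x :=
          Multiset.filter_cons_of_neg _ (by
            rwa [src_of_mem_support_couponLaw G lam hlam ha])
        rw [this, tail]
      rw [mean_congr _ head, mean_const_mul, mean_comm, List.count_cons_of_ne hy,
        List.erase_cons_tail (by simpa using hy)]
      simp only [netLaw_cons, mean_bind, mean_map]

theorem mean_netLaw_sample (x : V) (l : List V) (hl : 0 < l.count x)
    (K : Option (Coupon V) → Network V → ℝ≥0∞) (F : Coupon V → Network V → ℝ≥0∞)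
    (hK : ∀ c net, K (some c) net = F c (net.erase c)) :
    mean (netLaw G lam hlam l) (fun net =>
        mean ((uniformCounted (couponsOf net x)).map fun m => m.map Prod.fst)
          fun o => K o net) =
      mean (couponLaw G lam hlam x) fun c => mean (netLaw G lam hlam (l.erase x)) (F c) := by
  rw [← mean_pos_mul_inv hl (mean (couponLaw G lam hlam x) _), ← mean_netLaw_sum_erase, ← mean_const_mul]
  refine mean_congr _ fun net hnet => ?_
  have hcard := card_couponsOf_of_mem_support G lam hlam x l hnet
  rw [mean_map, mean_uniformCounted, if_neg, hcard]
  · simp only [Option.map_some, hK]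
  · rw [← Multiset.card_eq_zero, hcard]
    exact hl.ne'

/-! ### Phase 2 -/

variable {G}

/-- The list `l'` depends on neither the network nor the sampled coupon: the refill occurs exactly
when `t.holder` is absent from `l`. As `eta` is positive, the second sampling then succeeds. -/
theorem mean_stitch (hG : G.Connected) (eta : ℕ) (heta : 0 < eta)
    (bfs : Network V → (x : V) → PMF (BFSTree G x)) (t : Token V) (l : List V)
    (H : Option (Network V × Token V) → ℝ≥0∞) :
    ∃ l' : List V, mean (netLaw G lam hlam l) (fun net => mean (stitch lam eta bfs net t) H) =
      mean (couponLaw G lam hlam t.holder) fun c => mean (netLaw G lam hlam l') fun net =>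
        H (some (net, ⟨t.src, c.holder, t.done + c.hops⟩)) := by
  have sample : ∀ net : Network V, ((bfs net t.holder).bind fun T => sampleCoupon T net) =
      (uniformCounted (couponsOf net t.holder)).map fun m => m.map Prod.fst := by
    intro net
    simp only [sampleCoupon_eq hG, PMF.bind_const]
  simp only [stitch, sample]
  rcases Nat.eq_zero_or_pos (l.count t.holder) with hl | hl
  · refine ⟨(l ++ List.replicate eta t.holder).erase t.holder, ?_⟩
    rw [← mean_netLaw_sample G lam hlam t.holder _ (by simp [hl, heta])
      (fun o net => H (o.map (takeCoupon net t))) _ fun c net => rfl, netLaw_append, mean_bind]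
    refine mean_congr _ fun net hnet => ?_
    have hcard := card_couponsOf_of_mem_support G lam hlam t.holder l hnet
    rw [hl, Multiset.card_eq_zero] at hcard
    rw [hcard, uniformCounted, dif_pos rfl, PMF.pure_map, Option.map_none, PMF.pure_bind,
      sendMoreCoupons_eq G lam eta hlam]
    simp only [mean_bind, mean_map]
  · refine ⟨l.erase t.holder, ?_⟩
    simp only [mean_bind]
    rw [mean_netLaw_sample G lam hlam t.holder l hl _
      (fun c net => H (some (net, ⟨t.src, c.holder, t.done + c.hops⟩)))]
    intro c net
    rw [mean_pure]
    rfl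

/-- The list `l` must be arbitrary in the induction, since every stitch changes it. The fuel bound
persists because a stitch adds at least `lam ≥ 1` steps. -/
theorem mean_phaseTwo (hG : G.Connected) (ell eta : ℕ) (heta : 0 < eta)
    (bfs : Network V → (x : V) → PMF (BFSTree G x)) (s v : V) (fuel : ℕ) (l : List V)
    (x : V) (d : ℕ) (hd : d ≤ ell) (hfuel : ell ≤ d + fuel) :
    mean (netLaw G lam hlam l) (fun net =>
        mean (phaseTwo ell lam eta bfs fuel net ⟨s, x, d⟩)
          fun out => if out v = some s then 1 else 0) = walk G (ell - d) x v := by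
  induction fuel generalizing l x d with
  | zero =>
    have hdone : ¬ d + 2 * lam ≤ ell := by omega
    simp only [phaseTwo, if_neg hdone, mean_map, mean_const, outputs]
    rw [← mean_indicator]
    refine mean_congr _ fun y _ => ?_
    by_cases h : v = y <;> simp [h, eq_comm]
  | succ fuel ih =>
    by_cases hgo : d + 2 * lam ≤ ell
    · simp only [phaseTwo, if_pos hgo, mean_bind]
      obtain ⟨l', hl'⟩ := mean_stitch lam hlam hG eta heta bfs ⟨s, x, d⟩ l fun o =>
        mean (match o with
          | some (net', t') => phaseTwo ell lam eta bfs fuel net' t'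
          | none => PMF.pure fun _ => none) fun out => if out v = some s then 1 else 0
      refine hl'.trans ?_
      rw [mean_couponLaw]
      have each : ∀ r ∈ Finset.range lam, (mean (forwards G (lam + r) ⟨x, x, 0⟩) fun c =>
          mean (netLaw G lam hlam l') fun net =>
            mean (phaseTwo ell lam eta bfs fuel net ⟨s, c.holder, d + c.hops⟩)
              fun out => if out v = some s then 1 else 0) = walk G (ell - d) x v := by
        intro r hr
        have hr := Finset.mem_range.1 hr
        rw [forwards, mean_map]
        simp only [Nat.zero_add]
        -- No overshoot: `lam + r < 2 * lam ≤ ell - d`.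
        rw [mean_congr _ fun y _ => ih l' y (d + (lam + r)) (by omega) (by omega)]
        rw [show ell - d = (lam + r) + (ell - (d + (lam + r))) by omega, walk_add G (lam + r),
          PMF.bind_apply]
        rfl
      rw [Finset.sum_congr rfl each, Finset.sum_const, Finset.card_range, nsmul_eq_mul,
        mean_pos_mul_inv hlam]
    · simp only [phaseTwo, if_neg hgo, mean_map, mean_const, outputs]
      rw [← mean_indicator]
      refine mean_congr _ fun y _ => ?_
      by_cases h : v = y <;> simp [h, eq_comm]

end Stitching

end StitchedWalk

end

theorem mainTheorem3 {V : Type*} [Fintype V] [DecidableEq V] [Nontrivial V]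
    (G : SimpleGraph V) [DecidableRel G.Adj] (hG : G.Connected)
    (s : V) (ell lam eta : ℕ) (hlam : 0 < lam) (heta : 0 < eta)
    (bfs : StitchedWalk.Network V → (x : V) → PMF (StitchedWalk.BFSTree G x)) (v : V) :
    (StitchedWalk.singleRandomWalk ell lam eta hlam bfs s).toOuterMeasure
        {out : V → Option V | out v = some s} =
      StitchedWalk.walk G ell s v := by
  classical
  rw [StitchedWalk.toOuterMeasure_eq_mean, StitchedWalk.singleRandomWalk, StitchedWalk.mean_bind,
    StitchedWalk.phaseOne_eq]
  exact StitchedWalk.mean_phaseTwo lam hlam hG ell eta heta bfs s v ell _ s 0 (Nat.zero_le _)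
    (by omega)
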